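/- **Lemma (Hoop distortion).** *Simplices.* A $j$-simplex in $\mathbb R^m$ is a set of $j+1$ points; its faces are its nonempty subsets. For $p\in\sigma$ let $\sigma_p=\sigma\setminus\{p\}$ be the facet opposite $p$; the altitude of $p$ in $\sigma$ is its distance to the affine hull of $\sigma_p$. The thickness of a $j$-simplex $\sigma$ is $1$ if $j=0$, and otherwise its smallest altitude divided by $j$ times its longest edge length $\Delta(\sigma)$. A simplex is $\Gamma_0$-good if every $j$-dimensional face of it, for every $j$, has thickness at least $\Gamma_0^j$. If some ball has all vertices of $\sigma$ on its boundary, the smallest such ball $B(C(\sigma),R(\sigma))$ defines the circumcentre and the circumradius of $\sigma$; its boundary is the diametric sphere $S^{d}(\sigma)$, and $S(\sigma)=S^{d}(\sigma)\cap\operatorname{aff}(\sigma)$ is the circumsphere. *Input.* Let $\mathcal N$ be a finite set of labels, $M$ a topological space (in the application, a compact $m$-manifold), $P:\mathcal N\to M$ injective, and for each $i\in\mathcal N$ let $\varphi_i:W_i\to U_i\subseteq\mathbb R^m$ be a homeomorphism between open subsets of $M$ and $\mathbb R^m$ with $P(i)\in W_i$, and $\epsilon_i>0$. Write $p_j=\varphi_i(P(j))$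 in the patch $U_i$ whenever $P(j)\in W_i$, let $d_i$ be the Euclidean metric of $U_i$, $B_i$ its open balls, and let $\varphi_{ij}=\varphi_j\circ\varphi_i^{-1}$ be the transition function on $U_{ij}=\varphi_i(W_i\cap W_j)$. Let $\mu_0>0$, $\epsilon_0\ge0$, $\xi_0>0$ be such that 1. $B_i(p_i,8\epsilon_i)\subseteq U_i$, any two distinct points of $P_i=\varphi_i(W_i\cap P(\mathcal N))$ are at distance at least $\mu_0\epsilon_i$, and every $x\in B_i(p_i,8\epsilon_i)$ is at distance less than $\epsilon_i$ from $P_i$; 2. $|\epsilon_i-\epsilon_j|\le\epsilon_0\min\{\epsilon_i,\epsilon_j\}$ whenever $P(j)\in W_i$ and $d_i(p_i,p_j)\le6\epsilon_i$; 3. whenever $P(j)\in W_i$ and $p_j\in B_i(p_i,6\epsilon_i)$: $B_i(p_i,6\epsilon_i)\cap B_i(p_j,9\epsilon_i)\subseteq U_{ij}$, and $|d_i(x,y)-d_j(\varphi_{ij}(x),\varphi_{ij}(y))|\le\xi_0\,d_i(x,y)$ for all $x,y\in U_{ij}$. Assume also $\epsilon_0\le\frac{1-\xi_0}{1+\xi_0}$.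 *Perturbation.* Let $P':\mathcal N\to M$ satisfy $P'(i)\in W_i$ and $d_i(p_i',p_i)\le\rho\epsilon_i$ for all $i$, where $(1+\epsilon_0)(1+\xi_0)\rho\le\mu_0/4$ and $p'_j=\varphi_i(P'(j))$ in the patch $U_i$ whenever $P'(j)\in W_i$. Put $P'_i=\varphi_i(W_i\cap P'(\mathcal N))$ and $Q'_i=P'_i\cap B_i(p_i,6\epsilon_i)$. *Forbidden configurations.* Let $0<\Gamma_0\le1$ and $0\le\delta_0\le\Gamma_0^{m+1}$. A simplex $\tau\subseteq Q'_i$ of dimension at least $1$ is a forbidden configuration if, for every $p\in\tau$, the facet $\tau_p$ has a circumcentre, $\operatorname{dist}_i(p,S(\tau_p))\le\alpha_0R(\tau_p)$ with $\alpha_0=2^{13}\Gamma_0/\mu_0^3$, $R(\tau_p)<2\epsilon_i$, and $\tau_p$ is $\Gamma_0$-good, and moreover $\Delta(\tau)<\frac52(1+\frac12\delta_0\mu_0)\epsilon_i$. *Claim.* Suppose $$\xi_0\le\Big(\frac{\Gamma_0^{2m+1}}4\Big)^2 .$$ Let $i,j\in\mathcal N$ with $P(j)\in W_i$ and $p_j\in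 B_i(p_i,6\epsilon_i)$, and let $\tau=p'_j*\sigma\subseteq Q'_i$ (that is, $P'(j)\in W_i$, $\tau=\{p'_j\}\cup\sigma$, $p'_j\notin\sigma$) be a forbidden configuration. Then $\tau\subseteq U_{ij}$, the simplex $\tilde\sigma=\varphi_{ij}(\sigma)$ is contained in $P'_j$ and has a circumcentre, and $$\operatorname{dist}_j\big(p'_j,S^{d}(\tilde\sigma)\big)\le2\tilde\alpha_0\epsilon_j,\qquad\text{where}\quad\tilde\alpha_0=\frac{2^{16}m^{3/2}\Gamma_0}{\mu_0^3}.$$ -/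

import Mathlib

namespace HoopDistortion

section Simplices

/-! Abstract simplices of a Euclidean space are finite sets of points; a set with `j + 1` points
is a `j`-simplex, and its (nonempty) subsets are its faces. -/

variable {E : Type*} [NormedAddCommGroup E] [InnerProductSpace ℝ E]

/-- The altitude of `p` in `σ`: the distance from `p` to the affine hull of the opposite facet. -/
noncomputable def altitude (p : E) (σ : Set E) : ℝ :=
  Metric.infDist p (affineSpan ℝ (σ \ {p}) : Set E)

/-- The thickness of a `j`-simplex: `1` if `j = 0`, and otherwise the smallest altitude divided by
`j` times the longest edge length. -/
noncomputable def thickness (σ : Set E) : ℝ :=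
  if σ.ncard ≤ 1 then 1
  else (⨅ p : σ, altitude (p : E) σ) / (((σ.ncard : ℝ) - 1) * Metric.diam σ)

/-- `σ` is `Γ₀`-good: every `j`-dimensional face of `σ` has thickness at least `Γ₀ ^ j`. -/
def IsGood (Γ₀ : ℝ) (σ : Set E) : Prop :=
  ∀ ρ : Set E, ρ ⊆ σ → ρ.Nonempty → Γ₀ ^ (ρ.ncard - 1) ≤ thickness ρ

/-- The ball with centre `c` and radius `r` circumscribes `σ`: all the vertices of `σ` lie on its
boundary. -/
def IsCircumscribing (σ : Set E) (c : E) (r : ℝ) : Prop :=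
  ∀ q ∈ σ, dist q c = r

/-- `c` is the circumcentre and `r` the circumradius of `σ`: they are the centre and the radius of
the smallest circumscribing ball. The diametric sphere of `σ` is then `Metric.sphere c r`, and the
circumsphere of `σ` is its intersection with the affine hull of `σ`. -/
def IsSmallestCircumscribing (σ : Set E) (c : E) (r : ℝ) : Prop :=
  IsCircumscribing σ c r ∧ ∀ c' r', IsCircumscribing σ c' r' → r ≤ r'

/-- The `α`-hoop property of `τ`: each facet of `τ` has a circumcentre, and the distance from the
opposite vertex to the circumsphere of the facet is at most `α` times the circumradius. -/
def HasHoopProperty (α : ℝ) (τ : Set E) : Prop :=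
  ∀ p ∈ τ, ∃ (c : E) (r : ℝ), IsSmallestCircumscribing (τ \ {p}) c r ∧
    Metric.infDist p (Metric.sphere c r ∩ (affineSpan ℝ (τ \ {p}) : Set E)) ≤ α * r

/-- Forbidden configurations, for a local sampling radius `ε`: simplices of dimension at least one
with the four defining properties. -/
structure IsForbiddenConfiguration (Γ₀ δ₀ μ₀ ε : ℝ) (τ : Set E) : Prop where
  finite : τ.Finite
  two_le_ncard : 2 ≤ τ.ncard
  hoop : HasHoopProperty (2 ^ 13 * Γ₀ / μ₀ ^ 3) τ
  circumradius_lt : ∀ p ∈ τ, ∀ (c : E) (r : ℝ),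
    IsSmallestCircumscribing (τ \ {p}) c r → r < 2 * ε
  diam_lt : Metric.diam τ < 5 / 2 * (1 + 1 / 2 * δ₀ * μ₀) * ε
  good_facets : ∀ p ∈ τ, IsGood Γ₀ (τ \ {p})

/-- `P` is a `(μ, ε)`-net for `D`: it is `με`-separated, and `ε`-dense for `D`. -/
def IsNet (μ ε : ℝ) (D P : Set E) : Prop :=
  (∀ p ∈ P, ∀ q ∈ P, p ≠ q → μ * ε ≤ dist p q) ∧ ∀ x ∈ D, ∃ p ∈ P, dist x p < ε

end Simplices

section Patches

variable {m : ℕ} {N M : Type*} [TopologicalSpace M]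

/-- The points of the family `P`, indexed by labels and lying in `M`, that belong to the domain of
the `i`-th chart, seen in the `i`-th coordinate patch. -/
def patchPoints (chart : N → OpenPartialHomeomorph M (EuclideanSpace ℝ (Fin m))) (P : N → M)
    (i : N) : Set (EuclideanSpace ℝ (Fin m)) :=
  chart i '' ((chart i).source ∩ Set.range P)

/-- The transition function from the `i`-th to the `j`-th patch. Its source is the image under the
`i`-th chart of the intersection of the two chart domains. -/
def transition (chart : N → OpenPartialHomeomorph M (EuclideanSpace ℝ (Fin m))) (i j : N) :
    OpenPartialHomeomorph (EuclideanSpace ℝ (Fin m)) (EuclideanSpace ℝ (Fin m)) :=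
  (chart i).symm.trans (chart j)

/-- The assumptions on the input: charts, labelled sample points `P`, local sampling radii `ε`,
with separation parameter `μ₀`, bound `ε₀` on the variation of the sampling radius, and metric
distortion `ξ₀`. -/
structure InputAssumptions (chart : N → OpenPartialHomeomorph M (EuclideanSpace ℝ (Fin m)))
    (P : N → M) (ε : N → ℝ) (μ₀ ε₀ ξ₀ : ℝ) : Prop where
  injective : Function.Injective P
  separation_pos : 0 < μ₀
  variation_nonneg : 0 ≤ ε₀
  distortion_pos : 0 < ξ₀
  radius_pos : ∀ i, 0 < ε i
  mem_source : ∀ i, P i ∈ (chart i).source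
  ball_subset : ∀ i, Metric.ball (chart i (P i)) (8 * ε i) ⊆ (chart i).target
  net : ∀ i, IsNet μ₀ (ε i) (Metric.ball (chart i (P i)) (8 * ε i)) (patchPoints chart P i)
  radius_variation : ∀ i j, P j ∈ (chart i).source →
    dist (chart i (P i)) (chart i (P j)) ≤ 6 * ε i → |ε i - ε j| ≤ ε₀ * min (ε i) (ε j)
  domain_large : ∀ i j, P j ∈ (chart i).source →
    chart i (P j) ∈ Metric.ball (chart i (P i)) (6 * ε i) →
    Metric.ball (chart i (P i)) (6 * ε i) ∩ Metric.ball (chart i (P j)) (9 * ε i) ⊆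
      (transition chart i j).source
  distortion : ∀ i j, P j ∈ (chart i).source →
    chart i (P j) ∈ Metric.ball (chart i (P i)) (6 * ε i) →
    ∀ x ∈ (transition chart i j).source, ∀ y ∈ (transition chart i j).source,
      |dist x y - dist (transition chart i j x) (transition chart i j y)| ≤ ξ₀ * dist x y

/-- `P'` is obtained from `P` by moving each sample point by at most `ρ` times the local sampling
radius, measured in the patch of the point. -/
def IsPerturbation (chart : N → OpenPartialHomeomorph M (EuclideanSpace ℝ (Fin m)))
    (P P' : N → M) (ε : N → ℝ) (ρ : ℝ) : Prop :=
  ∀ i, P' i ∈ (chart i).source ∧ dist (chart i (P' i)) (chart i (P i)) ≤ ρ * ε i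

/-- The perturbed points seen in the region of interest of the `i`-th patch, the ball of radius
`6 * ε i` about the unperturbed point with label `i`. -/
def regionPoints (chart : N → OpenPartialHomeomorph M (EuclideanSpace ℝ (Fin m)))
    (P P' : N → M) (ε : N → ℝ) (i : N) : Set (EuclideanSpace ℝ (Fin m)) :=
  patchPoints chart P' i ∩ Metric.ball (chart i (P i)) (6 * ε i)

end Patches

end HoopDistortion

/-!
Everything about a simplex that matters here can be read off from its squared edge lengths, by
way of weights. For a family of points `v` and weights `w` of sum `t` (see `norm_sq_sum_smul`),
`‖∑ w v‖² = t ∑ w ‖v‖² - ½ ∑∑ w w' dist(v, v')²`. So a relative change of at most `η` in the squared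
edge lengths changes such an expression by at most a multiple of `η (∑ |w|)²`, and the question is
how large the weights can be.

Let `σ` be a good `k`-simplex of diameter `Δ` and put `G = Γ₀ ^ k`. The thickness of `σ` says that
its altitudes are at least `h = G k Δ`, equivalently `|w l| h ≤ ‖∑ w v‖` for all weights of sum `0`
(`HasAltitudeBound`). Three consequences are drawn from it.

* The simplex is affinely independent, hence `k ≤ m`, and so is its distorted image, because the
  distortion cannot bring `‖∑ w v‖` down to `0`
  (`HasAltitudeBound.affineIndependent_of_distortion`). In particular the image has a circumcentre.
* The circumradius satisfies `R ≤ Δ / (2 G)` (`IsGood.circumradius_le`).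
* A point `s = ∑ w v` of the circumsphere of `σ` has `∑ |w| ≤ 2 / G²`.

Now let `s` be the point of the circumsphere closest to `p`, and let `s' = ∑ w f(v)` be the
combination of the distorted vertices with the same weights. The weight formula compares
`dist(f p, s')²` with `dist(p, s)²`, and the power of `s'` with respect to the new diametric sphere
with the power of `s` with respect to the old one, which is `0`. Both squared errors are of order
at most `ξ₀ (∑ |w|)² (1 + α₀)² R²`, which the bound on `ξ₀` makes at most of order
`(Γ₀ (1 + α₀) R)²` (`infDist_sphere_le_add` and `IsGood.exists_circumscribing_image`). So `f p` is within
`R (2 α₀ + 4 Γ₀)` of the new sphere. The claim follows from `R < 2 εᵢ`, `εᵢ ≤ 2 εⱼ`, and from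
`Γ₀ ≤ α₀ / 1024`, which holds since density of the sample forces `μ₀ < 2`.
-/

namespace HoopDistortion

open scoped RealInnerProductSpace

/-! ### Weighted sums and the altitudes of a simplex -/

section Weights

variable {ι E F : Type*} [Fintype ι] [NormedAddCommGroup E] [InnerProductSpace ℝ E]
  [NormedAddCommGroup F] [InnerProductSpace ℝ F]

theorem norm_sq_sum_smul (w : ι → ℝ) (u : ι → E) :
    ‖∑ a, w a • u a‖ ^ 2 = (∑ a, w a) * ∑ a, w a * ‖u a‖ ^ 2 -
      1 / 2 * ∑ a, ∑ b, w a * w b * dist (u a) (u b) ^ 2 := by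
  have h1 : ‖∑ a, w a • u a‖ ^ 2 = ∑ a, ∑ b, w a * w b * ⟪u a, u b⟫ := by
    rw [← real_inner_self_eq_norm_sq, sum_inner]
    refine Finset.sum_congr rfl fun a _ => ?_
    rw [inner_sum]
    refine Finset.sum_congr rfl fun b _ => ?_
    rw [real_inner_smul_left, real_inner_smul_right]
    ring
  have h2 : ∀ a b, w a * w b * ⟪u a, u b⟫ = 1 / 2 * (w b * (w a * ‖u a‖ ^ 2)) +
      1 / 2 * (w a * (w b * ‖u b‖ ^ 2)) - 1 / 2 * (w a * w b * dist (u a) (u b) ^ 2) := by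
    intro a b
    rw [dist_eq_norm, norm_sub_sq_real]
    ring
  have h3 : ∑ a, ∑ b, w b * (w a * ‖u a‖ ^ 2) = (∑ a, w a) * ∑ a, w a * ‖u a‖ ^ 2 := by
    rw [Finset.sum_mul_sum, Finset.sum_comm]
  have h4 : ∑ a, ∑ b, w a * (w b * ‖u b‖ ^ 2) = (∑ a, w a) * ∑ a, w a * ‖u a‖ ^ 2 := by
    rw [Finset.sum_mul_sum]
  rw [h1]
  simp only [h2, Finset.sum_sub_distrib, Finset.sum_add_distrib, ← Finset.mul_sum _ _ (1 / 2 : ℝ)]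
  rw [h3, h4]
  ring

theorem norm_sq_sum_smul_of_sum_eq_zero {w : ι → ℝ} (hw : ∑ a, w a = 0) (v : ι → E) :
    ‖∑ a, w a • v a‖ ^ 2 = -(1 / 2 * ∑ a, ∑ b, w a * w b * dist (v a) (v b) ^ 2) := by
  rw [norm_sq_sum_smul, hw]
  ring

/-- With `x` a centre of a circumscribing sphere, this expresses the power of an affine combination
of the vertices with respect to that sphere by the edge lengths alone. -/
theorem dist_sq_sum_smul_of_sum_eq_one {w : ι → ℝ} (hw : ∑ a, w a = 1) (v : ι → E) (x : E) :
    dist x (∑ a, w a • v a) ^ 2 = ∑ a, w a * dist x (v a) ^ 2 -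
      1 / 2 * ∑ a, ∑ b, w a * w b * dist (v a) (v b) ^ 2 := by
  have h := norm_sq_sum_smul w fun a => v a - x
  simp only [smul_sub, Finset.sum_sub_distrib, ← Finset.sum_smul, hw, one_smul, one_mul,
    dist_sub_right] at h
  simp only [dist_comm x, dist_eq_norm (_ : E) x] at *
  exact h

theorem abs_sum_sum_sub_le {X Y : Type*} [PseudoMetricSpace X] [PseudoMetricSpace Y]
    {w : ι → ℝ} {v : ι → X} {v' : ι → Y} {η Δ : ℝ} (hη : 0 ≤ η)
    (hΔ : ∀ a b, dist (v a) (v b) ≤ Δ)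
    (hv : ∀ a b, |dist (v' a) (v' b) ^ 2 - dist (v a) (v b) ^ 2| ≤ η * dist (v a) (v b) ^ 2) :
    |∑ a, ∑ b, w a * w b * dist (v' a) (v' b) ^ 2 -
      ∑ a, ∑ b, w a * w b * dist (v a) (v b) ^ 2| ≤ (∑ a, |w a|) ^ 2 * (η * Δ ^ 2) := by
  rw [sq (∑ a, |w a|), Finset.sum_mul_sum, Finset.sum_mul, ← Finset.sum_sub_distrib]
  refine (Finset.abs_sum_le_sum_abs _ _).trans (Finset.sum_le_sum fun a _ => ?_)
  rw [Finset.sum_mul, ← Finset.sum_sub_distrib]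
  refine (Finset.abs_sum_le_sum_abs _ _).trans (Finset.sum_le_sum fun b _ => ?_)
  rw [← mul_sub, abs_mul, abs_mul]
  refine mul_le_mul_of_nonneg_left ((hv a b).trans ?_) (by positivity)
  have := hΔ a b
  gcongr

/-- The vector `∑ w v` is `w l` times the difference between `v l` and a point of the affine hull of
the other vertices. -/
theorem abs_weight_mul_infDist_le [DecidableEq ι] {w : ι → ℝ} (hw : ∑ a, w a = 0) (v : ι → E)
    (l : ι) :
    |w l| * Metric.infDist (v l) (affineSpan ℝ (v '' {l}ᶜ) : Set E) ≤ ‖∑ a, w a • v a‖ := by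
  rcases eq_or_ne (w l) 0 with h0 | h0
  · simp [h0]
  -- Dividing by `-w l` the weights of the other points yields a point `q` of the opposite facet.
  set μ : ι → ℝ := fun a => if a = l then 0 else -(w a / w l) with hμ
  have hsplit : ∀ a, w a = w l * ((if a = l then 1 else 0) - μ a) := by
    intro a
    by_cases h : a = l
    · simp [hμ, h]
    · simp only [hμ, h, if_false]
      field_simp
      ring
  have hμ1 : ∑ a, μ a = 1 := by
    have : w l * (1 - ∑ a, μ a) = 0 := by
      rw [← hw, Finset.sum_congr rfl fun a _ => hsplit a, ← Finset.mul_sum,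
        Finset.sum_sub_distrib]
      simp
    have := (mul_eq_zero.1 this).resolve_left h0
    linarith
  have hmem : ∑ a, μ a • v a ∈ affineSpan ℝ (v '' {l}ᶜ) := by
    rw [← Finset.affineCombination_eq_linear_combination _ _ _ hμ1]
    refine affineCombination_mem_affineSpan_image hμ1 (fun a _ ha => ?_) v
    have : a = l := by simpa using ha
    simp [hμ, this]
  have hsum : ∑ a, w a • v a = w l • (v l - ∑ a, μ a • v a) := by
    rw [Finset.sum_congr rfl fun a _ => by rw [hsplit a]]
    simp only [mul_smul, ← Finset.smul_sum, sub_smul, Finset.sum_sub_distrib, ite_smul, one_smul,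
      zero_smul, Finset.sum_ite_eq', Finset.mem_univ, if_true]
  rw [hsum, norm_smul, Real.norm_eq_abs, ← dist_eq_norm]
  exact mul_le_mul_of_nonneg_left (Metric.infDist_le_dist_of_mem hmem) (abs_nonneg _)

/-- Every altitude of the simplex with vertices `v` is at least `h`. This is encoded through weights
of sum zero, since `‖∑ a, w a • v a‖` is `|w l|` times the distance of `v l` from some point of the
affine hull of the other vertices; any such point arises from suitable weights. -/
def HasAltitudeBound (v : ι → E) (h : ℝ) : Prop :=
  ∀ w : ι → ℝ, ∑ a, w a = 0 → ∀ l, |w l| * h ≤ ‖∑ a, w a • v a‖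

theorem affineIndependent_of_weights {v : ι → E}
    (hv : ∀ w : ι → ℝ, ∑ a, w a = 0 → ∑ a, w a • v a = 0 → ∀ l, w l = 0) :
    AffineIndependent ℝ v := by
  rw [affineIndependent_iff_of_fintype]
  intro w hw h0
  rw [Finset.univ.weightedVSub_eq_linear_combination hw] at h0
  exact hv w hw h0

theorem HasAltitudeBound.affineIndependent {v : ι → E} {h : ℝ} (hv : HasAltitudeBound v h)
    (hh : 0 < h) : AffineIndependent ℝ v := by
  refine affineIndependent_of_weights fun w hw h0 l => ?_
  have := hv w hw l
  rw [h0, norm_zero] at this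
  exact abs_eq_zero.1 (le_antisymm (by nlinarith [abs_nonneg (w l)]) (abs_nonneg _))

/-- By `norm_sq_sum_smul_of_sum_eq_zero`, an affine dependence of the distorted vertices would make
`‖∑ a, w a • v a‖` too small for the altitude bound at the vertex of largest weight. -/
theorem HasAltitudeBound.affineIndependent_of_distortion {v : ι → E} {v' : ι → F} {h η Δ : ℝ}
    (hv : HasAltitudeBound v h) (hη : 0 ≤ η) (hh : 0 ≤ h)
    (hΔ : ∀ a b, dist (v a) (v b) ≤ Δ)
    (hd : ∀ a b, |dist (v' a) (v' b) ^ 2 - dist (v a) (v b) ^ 2| ≤ η * dist (v a) (v b) ^ 2)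
    (hlt : (Fintype.card ι) ^ 2 * (η * Δ ^ 2) < 2 * h ^ 2) :
    AffineIndependent ℝ v' := by
  refine affineIndependent_of_weights fun w hw h0 => ?_
  by_contra! hne
  obtain ⟨l₀, hl₀⟩ := hne
  -- A weight of largest absolute value is bounded below in terms of the sum of all of them.
  obtain ⟨l, -, hl⟩ := Finset.exists_max_image Finset.univ (fun a => |w a|) ⟨l₀, Finset.mem_univ _⟩
  have hpos : 0 < |w l| := (abs_pos.2 hl₀).trans_le (hl l₀ (Finset.mem_univ _))
  have hsum : ∑ a, |w a| ≤ Fintype.card ι * |w l| := by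
    refine (Finset.sum_le_sum hl).trans ?_
    simp
  have h1 := norm_sq_sum_smul_of_sum_eq_zero hw v
  have h2 := norm_sq_sum_smul_of_sum_eq_zero hw v'
  rw [h0, norm_zero] at h2
  have h3 := (abs_le.1 (abs_sum_sum_sub_le (w := w) hη hΔ hd)).2
  have h4 : (|w l| * h) ^ 2 ≤ ‖∑ a, w a • v a‖ ^ 2 := by
    have := hv w hw l
    gcongr
  have h5 : (∑ a, |w a|) ^ 2 * (η * Δ ^ 2) ≤ (Fintype.card ι * |w l|) ^ 2 * (η * Δ ^ 2) := by
    have : 0 ≤ ∑ a, |w a| := Finset.sum_nonneg fun a _ => abs_nonneg _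
    gcongr
  nlinarith [mul_lt_mul_of_pos_left hlt (sq_pos_of_pos hpos)]

theorem exists_weights_of_mem_affineSpan {v : ι → E} {x : E}
    (hx : x ∈ affineSpan ℝ (Set.range v)) : ∃ w : ι → ℝ, ∑ a, w a = 1 ∧ x = ∑ a, w a • v a := by
  obtain ⟨w, hw, rfl⟩ := eq_affineCombination_of_mem_affineSpan_of_fintype hx
  exact ⟨w, hw, Finset.affineCombination_eq_linear_combination _ _ _ hw⟩

/-- An equidistant point in the affine hull is the centre of the smallest circumscribing ball: any
other circumscribing ball `(c', r')` satisfies `r' ^ 2 = r ^ 2 + dist c' c ^ 2`. -/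
theorem isSmallestCircumscribing_of_weights [Nonempty ι] {v : ι → E} {κ : ι → ℝ} {r : ℝ}
    (hκ : ∑ a, κ a = 1)
    (hr : ∀ a, dist (v a) (∑ b, κ b • v b) = r) :
    IsSmallestCircumscribing (Set.range v) (∑ b, κ b • v b) r := by
  refine ⟨by rintro _ ⟨a, rfl⟩; exact hr a, fun c' r' h' => ?_⟩
  have key : ∀ x t, (∀ a, dist (v a) x = t) → dist x (∑ b, κ b • v b) ^ 2 =
      t ^ 2 - 1 / 2 * ∑ a, ∑ b, κ a * κ b * dist (v a) (v b) ^ 2 := by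
    intro x t hx
    rw [dist_sq_sum_smul_of_sum_eq_one hκ]
    simp only [dist_comm x, hx, ← Finset.sum_mul, hκ, one_mul]
  have h1 := key c' r' fun a => h' _ ⟨a, rfl⟩
  have h2 := key _ r hr
  rw [dist_self] at h2
  obtain ⟨a⟩ := ‹Nonempty ι›
  have h3 : 0 ≤ r' := (h' _ ⟨a, rfl⟩) ▸ dist_nonneg
  refine le_of_sq_le_sq ?_ h3
  nlinarith [sq_nonneg (dist c' (∑ b, κ b • v b))]

theorem _root_.AffineIndependent.exists_circumscribing_weights [Nonempty ι] {v : ι → E}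
    (hv : AffineIndependent ℝ v) :
    ∃ (κ : ι → ℝ) (r : ℝ), ∑ a, κ a = 1 ∧ ∀ a, dist (v a) (∑ b, κ b • v b) = r := by
  obtain ⟨⟨c, r⟩, ⟨hc, hr⟩, -⟩ := hv.existsUnique_dist_eq
  obtain ⟨κ, hκ, rfl⟩ := exists_weights_of_mem_affineSpan hc
  exact ⟨κ, r, hκ, fun a => hr ⟨a, rfl⟩⟩

/-- Barycentric coordinates are bounded by distance over altitude: the altitude bound is applied to
the difference between the given affine combination and the vertex `v a`. -/
theorem HasAltitudeBound.abs_weight_mul_le [DecidableEq ι] {v : ι → E} {h : ℝ}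
    (hv : HasAltitudeBound v h) {κ : ι → ℝ} (hκ : ∑ a, κ a = 1) {a l : ι} (hal : l ≠ a) :
    |κ l| * h ≤ dist (v a) (∑ b, κ b • v b) := by
  have := hv (fun b => κ b - if b = a then 1 else 0) (by simp [hκ]) l
  simpa [hal, sub_smul, Finset.sum_sub_distrib, dist_eq_norm', ite_smul] using this

/-- Circumradius against altitude. Writing the centre as `∑ κ v` and fixing a vertex `v a`, one has
`2 r² = ∑ κ b dist(v a, v b)²`; the term `b = a` vanishes, and each of the other `k` coordinates is
at most `r / h`. -/
theorem HasAltitudeBound.radius_mul_le {v : ι → E} {h Δ r : ℝ} {k : ℕ}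
    (hv : HasAltitudeBound v h) (hh : 0 ≤ h) (hcard : Fintype.card ι = k + 1)
    (hΔ : ∀ a b, dist (v a) (v b) ≤ Δ) {κ : ι → ℝ} (hκ : ∑ a, κ a = 1)
    (hr : ∀ a, dist (v a) (∑ b, κ b • v b) = r) :
    2 * (h * r) ≤ k * Δ ^ 2 := by
  classical
  have hne : Nonempty ι := Fintype.card_pos_iff.1 (by omega)
  obtain ⟨a⟩ := hne
  have hr0 : 0 ≤ r := hr a ▸ dist_nonneg
  have hΔ0 : 0 ≤ Δ := dist_nonneg.trans (hΔ a a)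
  have h1 := dist_sq_sum_smul_of_sum_eq_one hκ v (v a)
  have h2 := dist_sq_sum_smul_of_sum_eq_one hκ v (∑ b, κ b • v b)
  simp only [dist_comm (∑ b, κ b • v b) (v _), hr, ← Finset.sum_mul, hκ, dist_self] at h1 h2
  have h3 : 2 * r ^ 2 = ∑ b, κ b * dist (v a) (v b) ^ 2 := by linarith
  have h4 : h * (2 * r ^ 2) ≤ k * (r * Δ ^ 2) := by
    rw [h3, ← Finset.add_sum_erase _ _ (Finset.mem_univ a), dist_self]
    have hc : ((Finset.univ.erase a).card : ℝ) = k := by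
      rw [Finset.card_erase_of_mem (Finset.mem_univ _), Finset.card_univ, hcard]
      simp
    rw [← hc, ← nsmul_eq_mul, zero_pow two_ne_zero, mul_zero, zero_add, Finset.mul_sum]
    refine Finset.sum_le_card_nsmul _ _ _ fun b hb => ?_
    have h5 := hv.abs_weight_mul_le hκ (Finset.ne_of_mem_erase hb)
    rw [hr] at h5
    calc h * (κ b * dist (v a) (v b) ^ 2) ≤ (|κ b| * h) * dist (v a) (v b) ^ 2 := by
          have := le_abs_self (κ b)
          rw [← mul_assoc, mul_comm h]
          gcongr
      _ ≤ r * Δ ^ 2 := by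
          have := hΔ a b
          gcongr
  rcases hr0.eq_or_lt with h0 | h0
  · rw [← h0]
    simp only [mul_zero]
    positivity
  · refine le_of_mul_le_mul_right ?_ h0
    linarith

end Weights

/-! ### Distance to a sphere under distortion -/

section Comparison

variable {ι E F : Type*} [Fintype ι] [NormedAddCommGroup E] [InnerProductSpace ℝ E]
  [NormedAddCommGroup F] [InnerProductSpace ℝ F]

theorem abs_sub_le_of_abs_sq_sub_sq_le {a b B : ℝ} (ha : 0 ≤ a) (hb : 0 ≤ b) (hB : 0 ≤ B)
    (h : |a ^ 2 - b ^ 2| ≤ B ^ 2) : |a - b| ≤ B := by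
  refine abs_le_of_sq_le_sq ?_ hB
  obtain ⟨h1, h2⟩ := abs_le.1 h
  rcases le_total a b with hab | hab
  · nlinarith [mul_nonneg ha (sub_nonneg.2 hab)]
  · nlinarith [mul_nonneg hb (sub_nonneg.2 hab)]

/-- The point `z` only serves to make the sphere nonempty. -/
theorem infDist_sphere_le_abs {x c z : F} {r : ℝ} (hz : dist z c = r) :
    Metric.infDist x (Metric.sphere c r) ≤ |dist x c - r| := by
  have hr : 0 ≤ r := hz ▸ dist_nonneg
  rcases eq_or_ne x c with rfl | hne
  · refine (Metric.infDist_le_dist_of_mem (Metric.mem_sphere.2 hz)).trans ?_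
    rw [dist_comm, hz, dist_self, zero_sub, abs_neg]
    exact le_abs_self r
  · have hpos : 0 < ‖x - c‖ := norm_pos_iff.2 (sub_ne_zero.2 hne)
    have hmem : c + (r / ‖x - c‖) • (x - c) ∈ Metric.sphere c r := by
      rw [mem_sphere_iff_norm, add_sub_cancel_left, norm_smul, Real.norm_eq_abs,
        abs_of_nonneg (by positivity), div_mul_cancel₀ _ hpos.ne']
    refine (Metric.infDist_le_dist_of_mem hmem).trans (le_of_eq ?_)
    have : x - (c + (r / ‖x - c‖) • (x - c)) = (1 - r / ‖x - c‖) • (x - c) := by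
      rw [sub_smul, one_smul]
      abel
    rw [dist_eq_norm, this, norm_smul, Real.norm_eq_abs, dist_eq_norm x c]
    nth_rewrite 2 [← abs_of_pos hpos]
    rw [← abs_mul, sub_mul, one_mul, div_mul_cancel₀ _ hpos.ne']

/-- Let `s = ∑ w v` lie on the first sphere, within `δ` of `p`. The point `s' = ∑ w v'` is then
within `A` of `p'` and within `B` of the second sphere: the edge lengths determine the power of
`s'` and its distance from `p'`, and they barely change. -/
theorem infDist_sphere_le_add [Nonempty ι] {v : ι → E} {v' : ι → F} {p c : E} {p' c' : F}
    {w : ι → ℝ} {η Δ D r r' δ A B : ℝ} (hη : 0 ≤ η) (hw : ∑ a, w a = 1)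
    (hΔ : ∀ a b, dist (v a) (v b) ≤ Δ)
    (hd : ∀ a b, |dist (v' a) (v' b) ^ 2 - dist (v a) (v b) ^ 2| ≤ η * dist (v a) (v b) ^ 2)
    (hD : ∀ a, dist p (v a) ≤ D)
    (hp : ∀ a, |dist p' (v' a) ^ 2 - dist p (v a) ^ 2| ≤ η * dist p (v a) ^ 2)
    (hr : ∀ a, dist (v a) c = r) (hr' : ∀ a, dist (v' a) c' = r')
    (hs : dist (∑ a, w a • v a) c = r) (hps : dist p (∑ a, w a • v a) ≤ δ)
    (hA0 : 0 ≤ A) (hB0 : 0 ≤ B)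
    (hA : δ ^ 2 + (∑ a, |w a|) * (η * D ^ 2) + 1 / 2 * ((∑ a, |w a|) ^ 2 * (η * Δ ^ 2)) ≤ A ^ 2)
    (hB : 1 / 2 * ((∑ a, |w a|) ^ 2 * (η * Δ ^ 2)) ≤ B ^ 2) :
    Metric.infDist p' (Metric.sphere c' r') ≤ A + B := by
  obtain ⟨a₀⟩ := ‹Nonempty ι›
  have hr'0 : 0 ≤ r' := hr' a₀ ▸ dist_nonneg
  have hq := abs_le.1 (abs_sum_sum_sub_le (w := w) hη hΔ hd)
  -- The power of `∑ w v` with respect to the first sphere vanishes.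
  have h1 := dist_sq_sum_smul_of_sum_eq_one hw v c
  have h2 := dist_sq_sum_smul_of_sum_eq_one hw v' c'
  simp only [dist_comm c, dist_comm c', hr, hr', hs, ← Finset.sum_mul, hw, one_mul] at h1 h2
  have hB' : |dist (∑ a, w a • v' a) c' - r'| ≤ B := by
    refine abs_sub_le_of_abs_sq_sub_sq_le dist_nonneg hr'0 hB0 (le_trans ?_ hB)
    rw [h2, abs_le]
    constructor <;> linarith
  have h3 := dist_sq_sum_smul_of_sum_eq_one hw v p
  have h4 := dist_sq_sum_smul_of_sum_eq_one hw v' p'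
  have h5 : ∑ a, w a * dist p' (v' a) ^ 2 - ∑ a, w a * dist p (v a) ^ 2 ≤
      (∑ a, |w a|) * (η * D ^ 2) := by
    rw [← Finset.sum_sub_distrib, Finset.sum_mul]
    refine Finset.sum_le_sum fun a _ => ?_
    rw [← mul_sub]
    refine (le_abs_self _).trans ?_
    rw [abs_mul]
    refine mul_le_mul_of_nonneg_left ((hp a).trans ?_) (abs_nonneg _)
    have := hD a
    gcongr
  have h6 : dist p (∑ a, w a • v a) ^ 2 ≤ δ ^ 2 := by gcongr
  have hA' : dist p' (∑ a, w a • v' a) ≤ A := by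
    refine le_of_sq_le_sq (le_trans ?_ hA) hA0
    rw [h4]
    linarith
  calc Metric.infDist p' (Metric.sphere c' r')
      ≤ Metric.infDist (∑ a, w a • v' a) (Metric.sphere c' r') + dist p' (∑ a, w a • v' a) :=
        Metric.infDist_le_infDist_add_dist
    _ ≤ B + A := add_le_add ((infDist_sphere_le_abs (hr' a₀)).trans hB') hA'
    _ = A + B := add_comm _ _

theorem abs_sq_sub_sq_le_of_abs_sub_le {d d' ξ : ℝ} (hd : 0 ≤ d) (hd' : 0 ≤ d')
    (hξ : ξ ≤ 1 / 16) (h : |d - d'| ≤ ξ * d) : |d' ^ 2 - d ^ 2| ≤ 33 / 16 * ξ * d ^ 2 := by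
  have h1 : |d' ^ 2 - d ^ 2| = |d - d'| * (d + d') := by
    rw [abs_sub_comm d d', sq_sub_sq, abs_mul, abs_of_nonneg (add_nonneg hd' hd), mul_comm,
      add_comm d']
  have h2 : d' ≤ 17 / 16 * d := by
    have := (abs_le.1 h).1
    nlinarith
  rw [h1]
  calc |d - d'| * (d + d') ≤ (ξ * d) * (d + 17 / 16 * d) := by gcongr; exact (abs_nonneg _).trans h
    _ = 33 / 16 * ξ * d ^ 2 := by ring

end Comparison

/-! ### Good simplices -/

section GoodSimplices

variable {E F : Type*} [NormedAddCommGroup E] [InnerProductSpace ℝ E]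
  [NormedAddCommGroup F] [InnerProductSpace ℝ F]

theorem diam_pos_of_one_lt_ncard {X : Type*} [MetricSpace X] {σ : Set X}
    (hfin : σ.Finite) (h : 1 < σ.ncard) :
    0 < Metric.diam σ := by
  obtain ⟨a, b, ha, hb, hab⟩ := (Set.one_lt_ncard_iff hfin).1 h
  exact (dist_pos.2 hab).trans_le (Metric.dist_le_diam_of_mem hfin.isBounded ha hb)

theorem IsGood.le_altitude {Γ : ℝ} {σ : Set E} {k : ℕ} (hgood : IsGood Γ σ) (hfin : σ.Finite)
    (hk : 1 ≤ k) (hcard : σ.ncard = k + 1) {p : E} (hp : p ∈ σ) :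
    Γ ^ k * (k * Metric.diam σ) ≤ altitude p σ := by
  have h := hgood σ subset_rfl ⟨p, hp⟩
  have hΔ := diam_pos_of_one_lt_ncard hfin (by omega)
  have hk' : (0 : ℝ) < k := by exact_mod_cast hk
  rw [thickness, if_neg (by omega), hcard, Nat.add_sub_cancel] at h
  push_cast at h
  rw [add_sub_cancel_right, le_div_iff₀ (by positivity)] at h
  have hbdd : BddBelow (Set.range fun q : σ => altitude (q : E) σ) :=
    ⟨0, by rintro _ ⟨q, rfl⟩; exact Metric.infDist_nonneg⟩
  exact h.trans (ciInf_le hbdd ⟨p, hp⟩)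

theorem IsGood.hasAltitudeBound {Γ : ℝ} {σ : Set E} [Fintype σ] {k : ℕ} (hgood : IsGood Γ σ)
    (hk : 1 ≤ k) (hcard : σ.ncard = k + 1) :
    HasAltitudeBound (Subtype.val : σ → E) (Γ ^ k * (k * Metric.diam σ)) := by
  classical
  intro w hw l
  have himage : (Subtype.val : σ → E) '' {l}ᶜ = σ \ {(l : E)} := by
    ext x
    simp
  refine le_trans ?_ (abs_weight_mul_infDist_le hw _ l)
  rw [himage]
  exact mul_le_mul_of_nonneg_left (hgood.le_altitude σ.toFinite hk hcard l.2) (abs_nonneg _)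

theorem IsGood.le_finrank [FiniteDimensional ℝ E] {Γ : ℝ} {σ : Set E} {k : ℕ}
    (hgood : IsGood Γ σ) (hΓ : 0 < Γ) (hfin : σ.Finite) (hk : 1 ≤ k) (hcard : σ.ncard = k + 1) :
    k ≤ Module.finrank ℝ E := by
  have := hfin.fintype
  have hΔ := diam_pos_of_one_lt_ncard hfin (by omega)
  have hk' : (0 : ℝ) < k := by exact_mod_cast hk
  have h1 := (hgood.hasAltitudeBound hk hcard).affineIndependent (by positivity)
  have h2 := h1.card_le_finrank_succ
  have h3 := Submodule.finrank_le (vectorSpan ℝ (Set.range (Subtype.val : σ → E)))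
  rw [← Nat.card_eq_fintype_card, Nat.card_coe_set_eq, hcard] at h2
  omega

theorem IsGood.circumradius_le {Γ : ℝ} {σ : Set E} {k : ℕ} (hgood : IsGood Γ σ) (hΓ : 0 < Γ)
    (hfin : σ.Finite) (hk : 1 ≤ k) (hcard : σ.ncard = k + 1) {c : E} {r : ℝ}
    (hc : IsSmallestCircumscribing σ c r) : 2 * (Γ ^ k * r) ≤ Metric.diam σ := by
  have := hfin.fintype
  have hΔ := diam_pos_of_one_lt_ncard hfin (by omega)
  have hk' : (0 : ℝ) < k := by exact_mod_cast hk
  have hcard' : Fintype.card σ = k + 1 := by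
    rw [← Nat.card_eq_fintype_card, Nat.card_coe_set_eq, hcard]
  have : Nonempty σ := Fintype.card_pos_iff.1 (by omega)
  have hh : 0 < Γ ^ k * (k * Metric.diam σ) := by positivity
  have hv := hgood.hasAltitudeBound hk hcard
  obtain ⟨κ, r₀, hκ, hr₀⟩ := (hv.affineIndependent hh).exists_circumscribing_weights
  have h1 := hv.radius_mul_le hh.le hcard'
    (fun a b => Metric.dist_le_diam_of_mem hfin.isBounded a.2 b.2) hκ hr₀
  have h2 : r ≤ r₀ := hc.2 _ _ fun q hq => hr₀ ⟨q, hq⟩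
  have h3 : 2 * (Γ ^ k * r₀) ≤ Metric.diam σ := by
    refine le_of_mul_le_mul_right ?_ (mul_pos hk' hΔ)
    linarith
  refine le_trans ?_ h3
  gcongr

theorem IsCircumscribing.diam_le {X : Type*} [NormedAddCommGroup X] {σ : Set X} {c : X} {r : ℝ}
    (hc : IsCircumscribing σ c r)
    (hr : 0 ≤ r) : Metric.diam σ ≤ 2 * r := by
  refine Metric.diam_le_of_forall_dist_le (by positivity) fun x hx y hy => ?_
  have := dist_triangle_right x y c
  rw [hc x hx, hc y hy] at this
  linarith

/-- The image of a good simplex under a small distortion has a circumcentre, and the image of a point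
near the circumsphere is near the new diametric sphere. The power `(Γ ^ k) ^ 4` in the bound on `ξ`
offsets `(∑ |w|) ^ 2 ≤ 4 / (Γ ^ k) ^ 4`, and `Γ ^ 2` leaves a squared error of order
`(Γ * r) ^ 2`. -/
theorem IsGood.exists_circumscribing_image [ProperSpace E] {Γ ξ α r : ℝ} {σ : Set E} {k : ℕ}
    {p c : E} {f : E → F} (hgood : IsGood Γ σ) (hΓ : 0 < Γ) (hΓ1 : Γ ≤ 1) (hfin : σ.Finite)
    (hk : 1 ≤ k) (hcard : σ.ncard = k + 1) (hξ0 : 0 ≤ ξ) (hξ : 16 * ξ ≤ (Γ ^ k) ^ 4 * Γ ^ 2)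
    (hf : ∀ x ∈ insert p σ, ∀ y ∈ insert p σ, |dist x y - dist (f x) (f y)| ≤ ξ * dist x y)
    (hα : 0 ≤ α) (hc : IsSmallestCircumscribing σ c r)
    (hp : Metric.infDist p (Metric.sphere c r ∩ (affineSpan ℝ σ : Set E)) ≤ α * r) :
    ∃ (c' : F) (r' : ℝ), IsSmallestCircumscribing (f '' σ) c' r' ∧
      Metric.infDist (f p) (Metric.sphere c' r') ≤ r * (2 * α + 4 * Γ) := by
  classical
  have := hfin.fintype
  have hΔ := diam_pos_of_one_lt_ncard hfin (by omega)
  have hcard' : Fintype.card σ = k + 1 := by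
    rw [← Nat.card_eq_fintype_card, Nat.card_coe_set_eq, hcard]
  have hne : Nonempty σ := Fintype.card_pos_iff.1 (by omega)
  obtain ⟨a₀⟩ := id hne
  have hr0 : 0 ≤ r := (hc.1 _ a₀.2) ▸ dist_nonneg
  have hv := hgood.hasAltitudeBound hk hcard
  have hR := hgood.circumradius_le hΓ hfin hk hcard hc
  have hΔr := hc.1.diam_le hr0
  set Δ := Metric.diam σ
  set G := Γ ^ k
  have hG : 0 < G := by positivity
  have hG1 : G ≤ 1 := pow_le_one₀ hΓ.le hΓ1
  have hk1 : (1 : ℝ) ≤ k := by exact_mod_cast hk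
  have hG4 : G ^ 4 ≤ 1 := pow_le_one₀ hG.le hG1
  have hΓ2 : Γ ^ 2 ≤ 1 := pow_le_one₀ hΓ.le hΓ1
  have hξ16 : ξ ≤ 1 / 16 := by nlinarith [sq_nonneg Γ]
  have hdist : ∀ a b : σ, dist (a : E) b ≤ Δ := fun a b =>
    Metric.dist_le_diam_of_mem hfin.isBounded a.2 b.2
  have hd : ∀ x ∈ insert p σ, ∀ y ∈ insert p σ,
      |dist (f x) (f y) ^ 2 - dist x y ^ 2| ≤ 33 / 16 * ξ * dist x y ^ 2 := fun x hx y hy =>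
    abs_sq_sub_sq_le_of_abs_sub_le dist_nonneg dist_nonneg hξ16 (hf x hx y hy)
  have hdσ : ∀ a b : σ, |dist (f a) (f b) ^ 2 - dist (a : E) b ^ 2| ≤
      33 / 16 * ξ * dist (a : E) b ^ 2 := fun a b => hd a (.inr a.2) b (.inr b.2)
  have hη : 0 ≤ 33 / 16 * ξ := by positivity
  have hind : AffineIndependent ℝ fun a : σ => f a := by
    refine hv.affineIndependent_of_distortion (v' := fun a : σ => f a) hη (by positivity) hdist
      hdσ ?_
    rw [hcard']
    push_cast
    have h1 : ((k : ℝ) + 1) ^ 2 ≤ 4 * k ^ 2 := by nlinarith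
    have h2 : 33 / 16 * ξ * Δ ^ 2 ≤ 33 / 256 * G ^ 2 * Δ ^ 2 := by
      have : G ^ 4 * Γ ^ 2 ≤ G ^ 2 := by
        calc G ^ 4 * Γ ^ 2 ≤ G ^ 2 * 1 := mul_le_mul
              (pow_le_pow_of_le_one hG.le hG1 (by norm_num)) hΓ2 (by positivity) (by positivity)
          _ = G ^ 2 := mul_one _
      refine mul_le_mul_of_nonneg_right ?_ (sq_nonneg Δ)
      linarith
    calc ((k : ℝ) + 1) ^ 2 * (33 / 16 * ξ * Δ ^ 2) ≤
          (4 * k ^ 2) * (33 / 256 * G ^ 2 * Δ ^ 2) := by gcongr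
      _ = 33 / 64 * (G * (k * Δ)) ^ 2 := by ring
      _ < 2 * (G * (k * Δ)) ^ 2 := by
          have : 0 < (G * (k * Δ)) ^ 2 := by positivity
          linarith
  obtain ⟨κ, r', hκ, hr'⟩ := hind.exists_circumscribing_weights
  refine ⟨∑ b, κ b • f b, r', ?_, ?_⟩
  · rw [Set.image_eq_range]
    exact isSmallestCircumscribing_of_weights hκ hr'
  obtain ⟨s, ⟨hs, hs'⟩, hps⟩ : ∃ s ∈ Metric.sphere c r ∩ (affineSpan ℝ σ : Set E),
      Metric.infDist p (Metric.sphere c r ∩ (affineSpan ℝ σ : Set E)) = dist p s := by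
    have hfd : FiniteDimensional ℝ E := .of_locallyCompactSpace ℝ
    refine IsClosed.exists_infDist_eq_dist
      (Metric.isClosed_sphere.inter (AffineSubspace.closed_of_finiteDimensional _))
      ⟨(a₀ : E), hc.1 _ a₀.2, subset_affineSpan ℝ _ a₀.2⟩ p
  rw [hps] at hp
  rw [Metric.mem_sphere] at hs
  have hsv : ∀ a : σ, dist (a : E) s ≤ 2 * r := fun a => by
    have := dist_triangle_right (a : E) s c
    rw [hs, hc.1 _ a.2] at this
    linarith
  obtain ⟨w, hw, rfl⟩ : ∃ w : σ → ℝ, ∑ a, w a = 1 ∧ s = ∑ a, w a • (a : E) :=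
    exists_weights_of_mem_affineSpan (by simpa using hs')
  -- Since `r ≤ Δ / (2 * G)`, each weight is at most `1 / (k * G ^ 2)`, and there are `k + 1 ≤ 2 * k`
  -- of them.
  have hwl : ∀ l, |w l| * (k * G ^ 2) ≤ 1 := by
    intro l
    have : Nontrivial σ := Fintype.one_lt_card_iff_nontrivial.1 (by omega)
    obtain ⟨a, ha⟩ := exists_ne l
    have h1 := (hv.abs_weight_mul_le hw ha.symm).trans (hsv a)
    refine le_of_mul_le_mul_right (a := Δ) ?_ hΔ
    nlinarith
  have hsum : (∑ a, |w a|) * G ^ 2 ≤ 2 := by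
    have h1 : (∑ a, |w a|) * (k * G ^ 2) ≤ k + 1 := by
      rw [Finset.sum_mul]
      refine (Finset.sum_le_card_nsmul _ _ 1 fun a _ => hwl a).trans ?_
      simp [hcard']
    have h2 : 0 ≤ (∑ a, |w a|) := Finset.sum_nonneg fun a _ => abs_nonneg _
    refine le_of_mul_le_mul_left (a := (k : ℝ)) ?_ (by positivity)
    linarith
  set Λ := ∑ a, |w a|
  have hΛ0 : 0 ≤ Λ := Finset.sum_nonneg fun a _ => abs_nonneg _
  have hΛ2 : Λ ^ 2 * ξ ≤ Γ ^ 2 / 4 := by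
    have : (Λ * G ^ 2) ^ 2 ≤ 2 ^ 2 := by gcongr
    nlinarith [mul_le_mul_of_nonneg_left hξ (sq_nonneg Λ),
      mul_le_mul_of_nonneg_right this (sq_nonneg Γ)]
  have hΛ1 : Λ * ξ ≤ Γ ^ 2 / 8 := by
    have h1 : Λ * G ^ 4 ≤ 2 := by
      refine le_trans ?_ hsum
      gcongr Λ * ?_
      exact pow_le_pow_of_le_one hG.le hG1 (by norm_num)
    nlinarith [mul_le_mul_of_nonneg_left hξ hΛ0, mul_le_mul_of_nonneg_right h1 (sq_nonneg Γ)]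
  have hD : ∀ a : σ, dist p (a : E) ≤ (2 + α) * r := fun a => by
    have := dist_triangle_right p (a : E) (∑ a, w a • (a : E))
    linarith [hsv a]
  have hB : 1 / 2 * (Λ ^ 2 * (33 / 16 * ξ * Δ ^ 2)) ≤ 33 / 32 * (Γ * r) ^ 2 := by
    calc 1 / 2 * (Λ ^ 2 * (33 / 16 * ξ * Δ ^ 2)) = 33 / 32 * (Λ ^ 2 * ξ) * Δ ^ 2 := by ring
      _ ≤ 33 / 32 * (Γ ^ 2 / 4) * (2 * r) ^ 2 := by gcongr
      _ = 33 / 32 * (Γ * r) ^ 2 := by ring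
  have hA : Λ * (33 / 16 * ξ * ((2 + α) * r) ^ 2) ≤ 33 / 128 * (Γ * (2 + α)) ^ 2 * r ^ 2 := by
    calc Λ * (33 / 16 * ξ * ((2 + α) * r) ^ 2) = 33 / 16 * (Λ * ξ) * ((2 + α) * r) ^ 2 := by ring
      _ ≤ 33 / 16 * (Γ ^ 2 / 8) * ((2 + α) * r) ^ 2 := by gcongr
      _ = 33 / 128 * (Γ * (2 + α)) ^ 2 * r ^ 2 := by ring
  have hΓα : (Γ * (2 + α)) ^ 2 ≤ (2 * Γ + α) ^ 2 := by
    gcongr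
    nlinarith
  refine (infDist_sphere_le_add (v := fun a : σ => (a : E)) (v' := fun a : σ => f a) (p := p)
    (c := c) (A := r * (2 * α + 2 * Γ)) (B := r * (2 * Γ)) hη hw hdist hdσ hD
    (fun a => hd p (.inl rfl) a (.inr a.2)) (fun a => hc.1 _ a.2) hr' hs hp (by positivity)
    (by positivity) ?_ ?_).trans_eq (by ring)
  · have h1 := mul_le_mul_of_nonneg_right hΓα (sq_nonneg r)
    have h2 : 0 ≤ Γ * α * r ^ 2 := by positivity
    have h3 : (r * (2 * α + 2 * Γ)) ^ 2 =
        4 * (α * r) ^ 2 + 8 * (Γ * α * r ^ 2) + 4 * (Γ * r) ^ 2 := by ring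
    have h4 : (2 * Γ + α) ^ 2 * r ^ 2 =
        4 * (Γ * r) ^ 2 + 4 * (Γ * α * r ^ 2) + (α * r) ^ 2 := by ring
    rw [h4] at h1
    rw [h3]
    linarith [sq_nonneg (Γ * r), sq_nonneg (α * r)]
  · nlinarith [sq_nonneg (Γ * r)]

end GoodSimplices

/-! ### Hoops around a single vertex -/

section HoopProperty

variable {E : Type*} [NormedAddCommGroup E] [InnerProductSpace ℝ E]

/-- If `σ` were a single vertex then its circumsphere would be that vertex and `r` would be `0`, so
that `p` would lie in `σ`. -/
theorem two_le_ncard_of_infDist_circumsphere_le {σ : Set E} {p c : E} {α r : ℝ} (hfin : σ.Finite)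
    (hne : σ.Nonempty) (hp : p ∉ σ) (hc : IsSmallestCircumscribing σ c r)
    (h : Metric.infDist p (Metric.sphere c r ∩ (affineSpan ℝ σ : Set E)) ≤ α * r) :
    2 ≤ σ.ncard := by
  by_contra! hlt
  have h1 : σ.ncard = 1 := by
    have := (Set.ncard_pos hfin).2 hne
    omega
  obtain ⟨q, rfl⟩ := Set.ncard_eq_one.1 h1
  have hq : dist q c = r := hc.1 q rfl
  have hr : r = 0 := by
    refine le_antisymm (hc.2 q 0 ?_) (hq ▸ dist_nonneg)
    rintro _ rfl
    exact dist_self _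
  subst hr
  have hmem : q ∈ Metric.sphere c 0 ∩ (affineSpan ℝ {q} : Set E) :=
    ⟨hq, subset_affineSpan ℝ _ rfl⟩
  rw [mul_zero] at h
  have h2 : p ∈ closure (Metric.sphere c 0 ∩ (affineSpan ℝ {q} : Set E)) :=
    (Metric.mem_closure_iff_infDist_zero ⟨q, hmem⟩).2 (le_antisymm h Metric.infDist_nonneg)
  have h3 : dist p c = 0 := by
    have := closure_mono Set.inter_subset_left h2
    rwa [Metric.isClosed_sphere.closure_eq] at this
  exact hp ((dist_eq_zero.1 h3).trans (dist_eq_zero.1 hq).symm)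

end HoopProperty

/-! ### Coordinate patches -/

section Patches

variable {m : ℕ} {N M : Type*} [TopologicalSpace M]
  {chart : N → OpenPartialHomeomorph M (EuclideanSpace ℝ (Fin m))} {P P' : N → M} {ε : N → ℝ}
  {μ₀ ε₀ ξ₀ ρ : ℝ}

theorem chart_mem_transition_source {i j : N} {z : M} (hi : z ∈ (chart i).source)
    (hj : z ∈ (chart j).source) : chart i z ∈ (transition chart i j).source := by
  rw [transition, OpenPartialHomeomorph.trans_source]
  refine ⟨(chart i).map_source hi, ?_⟩
  rwa [Set.mem_preimage, (chart i).left_inv hi]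

theorem transition_chart {i j : N} {z : M} (hi : z ∈ (chart i).source) :
    transition chart i j (chart i z) = chart j z := by
  simp [transition, (chart i).left_inv hi]

theorem mem_source_of_chart_mem_transition_source {i j : N} {z : M} (hi : z ∈ (chart i).source)
    (hz : chart i z ∈ (transition chart i j).source) : z ∈ (chart j).source := by
  rw [transition, OpenPartialHomeomorph.trans_source] at hz
  have := hz.2
  rwa [Set.mem_preimage, (chart i).left_inv hi] at this

/-- A sample point that is `ε i`-close to a point at distance `ε i` from the `i`-th sample point
differs from the latter and is less than `2 * ε i` away from it. -/
theorem InputAssumptions.separation_lt_two (h : InputAssumptions chart P ε μ₀ ε₀ ξ₀)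
    (hm : 1 ≤ m) (i : N) : μ₀ < 2 := by
  have hε := h.radius_pos i
  have : Nonempty (Fin m) := ⟨⟨0, hm⟩⟩
  obtain ⟨x, hx⟩ : ∃ x : EuclideanSpace ℝ (Fin m), dist x (chart i (P i)) = ε i := by
    obtain ⟨x, hx⟩ := (NormedSpace.sphere_nonempty (x := chart i (P i)) (r := ε i)).2 hε.le
    exact ⟨x, hx⟩
  obtain ⟨q, hq, hxq⟩ := (h.net i).2 x (by rw [Metric.mem_ball]; linarith)
  have hne : chart i (P i) ≠ q := by
    rintro rfl
    linarith
  have h1 := (h.net i).1 _ ⟨P i, ⟨h.mem_source i, ⟨i, rfl⟩⟩, rfl⟩ q hq hne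
  have h2 := dist_triangle_left (chart i (P i)) q x
  nlinarith

/-- The displacement of the `j`-th point is controlled in its own patch; the distortion bound carries
it over to the `i`-th patch. -/
theorem InputAssumptions.dist_perturbed_lt (h : InputAssumptions chart P ε μ₀ ε₀ ξ₀)
    (hξ₀ : ξ₀ ≤ 1 / 16) (hμ₀ : μ₀ < 2)
    (hρ : (1 + ε₀) * (1 + ξ₀) * ρ ≤ μ₀ / 4) (hP' : IsPerturbation chart P P' ε ρ) {i j : N}
    (hj : P j ∈ (chart i).source)
    (hij : chart i (P j) ∈ Metric.ball (chart i (P i)) (6 * ε i))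
    (hj' : P' j ∈ (chart i).source) : dist (chart i (P' j)) (chart i (P j)) < ε i := by
  have hεi := h.radius_pos i
  have hεj := h.radius_pos j
  have hd := h.distortion i j hj hij _ (chart_mem_transition_source hj' (hP' j).1) _
    (chart_mem_transition_source hj (h.mem_source j))
  rw [transition_chart hj', transition_chart hj] at hd
  have h1 := (abs_le.1 hd).2
  have h2 := (hP' j).2
  -- A negative `ρ` is impossible, because it bounds a distance.
  have hρ0 : 0 ≤ ρ := by
    by_contra! hneg
    nlinarith [dist_nonneg (x := chart j (P' j)) (y := chart j (P j))]
  have hξ := h.distortion_pos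
  have hε0 := h.variation_nonneg
  have h3 : (1 + ε₀) * ρ < 1 / 2 := by
    have : 0 ≤ (1 + ε₀) * ρ * ξ₀ := by positivity
    nlinarith
  have h4 : ε j ≤ (1 + ε₀) * ε i := by
    rw [Metric.mem_ball, dist_comm] at hij
    have h5 := (abs_le.1 (h.radius_variation i j hj hij.le)).1
    have := mul_le_mul_of_nonneg_left (min_le_left (ε i) (ε j)) hε0
    linarith
  have h5 : ρ * ε j < 1 / 2 * ε i := by
    calc ρ * ε j ≤ ρ * ((1 + ε₀) * ε i) := by gcongr
      _ = (1 + ε₀) * ρ * ε i := by ring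
      _ < 1 / 2 * ε i := by gcongr
  have h6 : ξ₀ * dist (chart i (P' j)) (chart i (P j)) ≤
      1 / 16 * dist (chart i (P' j)) (chart i (P j)) := by gcongr
  linarith

end Patches

end HoopDistortion

/-! ### Distortion of forbidden configurations -/

theorem mainTheorem5 {m : ℕ} {N M : Type*} [Finite N] [TopologicalSpace M]
    (chart : N → OpenPartialHomeomorph M (EuclideanSpace ℝ (Fin m)))
    (P P' : N → M) (ε : N → ℝ) (μ₀ ε₀ ξ₀ ρ Γ₀ δ₀ : ℝ)
    (hinput : HoopDistortion.InputAssumptions chart P ε μ₀ ε₀ ξ₀)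
    (hε₀ : ε₀ ≤ (1 - ξ₀) / (1 + ξ₀))
    (hρ : (1 + ε₀) * (1 + ξ₀) * ρ ≤ μ₀ / 4)
    (hP' : HoopDistortion.IsPerturbation chart P P' ε ρ)
    (hΓ₀_pos : 0 < Γ₀) (hΓ₀_le : Γ₀ ≤ 1)
    (hδ₀_nonneg : 0 ≤ δ₀) (hδ₀_le : δ₀ ≤ Γ₀ ^ (m + 1))
    (hξ₀ : ξ₀ ≤ (Γ₀ ^ (2 * m + 1) / 4) ^ 2)
    (i j : N) (hj : P j ∈ (chart i).source)
    (hij : chart i (P j) ∈ Metric.ball (chart i (P i)) (6 * ε i))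
    (hj' : P' j ∈ (chart i).source)
    (σ : Set (EuclideanSpace ℝ (Fin m))) (hσ : chart i (P' j) ∉ σ)
    (hτ_sub : insert (chart i (P' j)) σ ⊆ HoopDistortion.regionPoints chart P P' ε i)
    (hτ : HoopDistortion.IsForbiddenConfiguration Γ₀ δ₀ μ₀ (ε i) (insert (chart i (P' j)) σ)) :
    insert (chart i (P' j)) σ ⊆ (HoopDistortion.transition chart i j).source ∧
    HoopDistortion.transition chart i j '' σ ⊆ HoopDistortion.patchPoints chart P' j ∧
    ∃ (c : EuclideanSpace ℝ (Fin m)) (r : ℝ),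
      HoopDistortion.IsSmallestCircumscribing (HoopDistortion.transition chart i j '' σ) c r ∧
      Metric.infDist (chart j (P' j)) (Metric.sphere c r) ≤
        2 * (2 ^ 16 * (m : ℝ) ^ ((3 : ℝ) / 2) * Γ₀ / μ₀ ^ 3) * ε j := by
  have hεi := hinput.radius_pos i
  have hεj := hinput.radius_pos j
  have hμ := hinput.separation_pos
  have hξ := hinput.distortion_pos
  set p := chart i (P' j) with hp_def
  have hfin : σ.Finite := hτ.finite.subset (Set.subset_insert _ _)
  have hface : insert p σ \ {p} = σ := by
    ext x
    simp only [Set.mem_sdiff, Set.mem_insert_iff, Set.mem_singleton_iff]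
    constructor
    · rintro ⟨h | h, h'⟩
      exacts [absurd h h', h]
    · exact fun h => ⟨.inr h, fun h' => hσ (h' ▸ h)⟩
  obtain ⟨c, r, hc, hhoop⟩ := hτ.hoop p (Set.mem_insert _ _)
  have hr := hτ.circumradius_lt p (Set.mem_insert _ _) c r
  have hgood := hτ.good_facets p (Set.mem_insert _ _)
  rw [hface] at hc hhoop hr hgood
  replace hr := hr hc
  have hne : σ.Nonempty := by
    have := hτ.two_le_ncard
    rw [Set.ncard_insert_of_notMem hσ hfin] at this
    exact (Set.ncard_pos hfin).1 (by omega)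
  have hcard := HoopDistortion.two_le_ncard_of_infDist_circumsphere_le hfin hne hσ hc hhoop
  obtain ⟨k, hk, hcard⟩ : ∃ k, 1 ≤ k ∧ σ.ncard = k + 1 := ⟨σ.ncard - 1, by omega, by omega⟩
  have hkm : k ≤ m := by
    simpa using hgood.le_finrank hΓ₀_pos hfin hk hcard
  have hμ2 := hinput.separation_lt_two (hk.trans hkm) i
  have hε₀1 : ε₀ ≤ 1 := hε₀.trans ((div_le_one (by linarith)).2 (by linarith))
  have hξk : 16 * ξ₀ ≤ (Γ₀ ^ k) ^ 4 * Γ₀ ^ 2 := by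
    have h1 : (Γ₀ ^ (2 * m + 1)) ^ 2 ≤ (Γ₀ ^ k) ^ 4 * Γ₀ ^ 2 := by
      rw [← pow_mul, ← pow_mul, ← pow_add]
      exact pow_le_pow_of_le_one hΓ₀_pos.le hΓ₀_le (by omega)
    linarith [div_pow (Γ₀ ^ (2 * m + 1)) 4 2]
  have hξ16 : ξ₀ ≤ 1 / 16 := by
    have h1 : (Γ₀ ^ k) ^ 4 * Γ₀ ^ 2 ≤ 1 := by
      rw [← pow_mul, ← pow_add]
      exact pow_le_one₀ hΓ₀_pos.le hΓ₀_le
    linarith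
  have hpert := hinput.dist_perturbed_lt hξ16 hμ2 hρ hP' hj hij hj'
  have hdiam : Metric.diam (insert p σ) < 5 * ε i := by
    refine hτ.diam_lt.trans_le ?_
    have h1 : δ₀ ≤ 1 := hδ₀_le.trans (pow_le_one₀ hΓ₀_pos.le hΓ₀_le)
    have h2 : δ₀ * μ₀ ≤ 2 := by nlinarith
    gcongr
    linarith
  have hsource : insert p σ ⊆ (HoopDistortion.transition chart i j).source := by
    intro x hx
    refine hinput.domain_large i j hj hij ⟨(hτ_sub hx).2, ?_⟩
    have h1 := Metric.dist_le_diam_of_mem hτ.finite.isBounded hx (Set.mem_insert p σ)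
    have h2 := dist_triangle x p (chart i (P j))
    rw [Metric.mem_ball]
    linarith
  refine ⟨hsource, ?_, ?_⟩
  · rintro _ ⟨x, hx, rfl⟩
    obtain ⟨⟨z, ⟨hz, l, rfl⟩, rfl⟩, -⟩ := hτ_sub (.inr hx)
    rw [HoopDistortion.transition_chart hz]
    exact ⟨P' l, ⟨HoopDistortion.mem_source_of_chart_mem_transition_source hz
      (hsource (.inr hx)), l, rfl⟩, rfl⟩
  set α := 2 ^ 13 * Γ₀ / μ₀ ^ 3 with hα_def
  have hα : 0 < α := by positivity
  obtain ⟨c', r', hc', hd'⟩ := hgood.exists_circumscribing_image hΓ₀_pos hΓ₀_le hfin hk hcard hξ.le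
    hξk (fun x hx y hy => hinput.distortion i j hj hij x (hsource hx) y (hsource hy)) hα.le hc hhoop
  rw [hp_def, HoopDistortion.transition_chart hj'] at hd'
  refine ⟨c', r', hc', hd'.trans ?_⟩
  have hΓα : 1024 * Γ₀ ≤ α := by
    rw [hα_def, le_div_iff₀ (by positivity)]
    have : μ₀ ^ 3 ≤ 2 ^ 3 := by gcongr
    nlinarith
  have hεij : ε i ≤ 2 * ε j := by
    rw [Metric.mem_ball, dist_comm] at hij
    have h1 := (abs_le.1 (hinput.radius_variation i j hj hij.le)).2
    have h2 : ε₀ * min (ε i) (ε j) ≤ 1 * ε j :=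
      mul_le_mul hε₀1 (min_le_right _ _) (le_min hεi.le hεj.le) zero_le_one
    linarith
  have hm1 : (1 : ℝ) ≤ (m : ℝ) ^ ((3 : ℝ) / 2) :=
    Real.one_le_rpow (by exact_mod_cast hk.trans hkm) (by norm_num)
  calc r * (2 * α + 4 * Γ₀) ≤ (4 * ε j) * (4 * α) := by
        refine mul_le_mul (by linarith) (by linarith) (by positivity) (by positivity)
    _ = 16 * α * 1 * ε j := by ring
    _ ≤ 16 * α * (m : ℝ) ^ ((3 : ℝ) / 2) * ε j := by gcongr
    _ = 2 * (2 ^ 16 * (m : ℝ) ^ ((3 : ℝ) / 2) * Γ₀ / μ₀ ^ 3) * ε j := by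
        rw [hα_def]
        ring
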